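/- Let $k$ be an algebraically closed field of characteristic $0$ and let $H$ be a Hopf algebra over $k$. Let $G(H)$ be the group of group-like elements of $H$ and $C_0=kG(H)$ its linear span. A nonzero element $y\in H$ is called skew primitive of weight $\mu(y)=g\in G(H)$ if $\Delta(y)=y\otimes 1+g\otimes y$. Let $W\subseteq G(H)$ be the set of the weights of all skew primitive elements $y\notin C_0$. If $y\notin C_0$ is skew primitive and there is a scalar $c\in k^\times$ such that $\mu(y)^{-1}\,y\,\mu(y)-c\,y\in C_0$, then this (unique) $c$ is called the commutator $\gamma(y)$ of $y$. Let $\Gamma\subseteq k^\times$ be the set of all $\gamma(y)$, where $y\notin C_0$ runs over the skew primitive elements for which $\gamma(y)$ exists. Write $\langle W\rangle\subseteq G(H)$ and $\langle\Gamma\rangle\subseteq k^\times$ for the generated subgroups, and $\operatorname{rank}$ for the torsionfree rank of an abelian group. **Proposition 0.5.** Suppose that $\langle W\rangle$ is abelian and torsionfree. If $$\operatorname{rank}\langle\Gamma\rangle>\operatorname{rank}\langle W\rangle=1,$$ then $H$ has exponential growth, that is, there are a finite-dimensional subspace $V\subseteq H$ and a real number $c>1$ such that $\dim_k (k1+V)^n\ge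 c^n$ for all $n\ge 0$. -/

import Mathlib

open scoped TensorProduct
open scoped IsMulCommutative

namespace HopfGrowth

section Hopf

variable (k : Type*) (H : Type*) [Field k] [Ring H] [HopfAlgebra k H]

/-- `C₀ = k G(H)`, the linear span of the group-like elements of `H`. -/
def groupLikeSpan : Submodule k H :=
  Submodule.span k (Set.range (GroupLike.val : GroupLike k H → H))

variable {k H}

/-- `y` is a skew primitive element (that is, a `(1, g)`-primitive element) of weight `g`:
`y ≠ 0` and `Δ y = y ⊗ 1 + g ⊗ y`. -/
def IsSkewPrimitive (g : GroupLike k H) (y : H) : Prop :=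
  y ≠ 0 ∧ CoalgebraStruct.comul (R := k) y = y ⊗ₜ[k] (1 : H) + (g : H) ⊗ₜ[k] y

/-- `c` is the commutator of the skew primitive element `y` with its weight `g`:
`g⁻¹ y g - c y ∈ C₀`. -/
def IsCommutator (g : GroupLike k H) (y : H) (c : kˣ) : Prop :=
  ((g⁻¹ : GroupLike k H) : H) * y * (g : H) - (c : k) • y ∈ groupLikeSpan k H

variable (k H)

/-- The set `W` of weights of the skew primitive elements of `H` that are not in `C₀`. -/
def weights : Set (GroupLike k H) :=
  {g | ∃ y : H, IsSkewPrimitive g y ∧ y ∉ groupLikeSpan k H}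

/-- The set `Γ` of commutators of the skew primitive elements of `H` that are not in `C₀` and whose
commutator exists. -/
def commutators : Set kˣ :=
  {c | ∃ (g : GroupLike k H) (y : H),
    IsSkewPrimitive g y ∧ y ∉ groupLikeSpan k H ∧ IsCommutator g y c}

end Hopf

/-- The torsionfree rank of an abelian group written multiplicatively: the supremum of the
cardinalities of its `ℤ`-linearly independent subsets. -/
noncomputable def torsionfreeRank (A : Type*) [CommGroup A] : Cardinal :=
  Module.rank ℤ (Additive A)

section Growth

variable (k : Type*) {A : Type*} [Field k] [Ring A] [Algebra k A]

/-- The growth function `n ↦ dim (k + V + V² + ⋯ + Vⁿ)` of a subspace `V` of an algebra; note that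
`(k + V)ⁿ = k + V + ⋯ + Vⁿ`. -/
noncomputable def growthFunction (V : Submodule k A) (n : ℕ) : ℕ :=
  Module.finrank k ↥((1 ⊔ V) ^ n)

variable (A)

/-- An algebra has exponential growth if the growth function of some finite dimensional subspace
is bounded below by an exponential function `cⁿ` with `c > 1` (it is always bounded above by such
a function). -/
def HasExponentialGrowth : Prop :=
  ∃ V : Submodule k A, FiniteDimensional k V ∧
    ∃ c : ℝ, 1 < c ∧ ∀ n : ℕ, c ^ n ≤ (growthFunction k V n : ℝ)

end Growth

end HopfGrowth

/-! Two skew primitive elements `y₀`, `y₁` that are eigenvectors modulo `C₀` for conjugation by both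
weights behave like a braided vector space of diagonal type. If the full twist acts by `1` on no
word of length at least two, all words in them are linearly independent, and the `2 ^ n` words of
length `n` give exponential growth.

Freeness (`eq_zero_of_evalWords_mem_wordFiltration`): in the coproduct of a homogeneous relation
`a`, the part with second factor of degree one shows, modulo lower degree, that each skew derivative
`∂ᵢ a` is again a relation. By induction all `∂ᵢ a` vanish, so it remains to see that `E = ∑ xᵢ ∂ᵢ`
is injective in positive degree (`eq_zero_of_eulerOp_eq_zero`). This follows from `E (1 - R) = (1 -
R') E'`, where `R` is `rotate`, `R'` is `rotateTail` and `E'` is `E` applied to all but the last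
letter. In degree `n`, both `R ^ n` and `R' ^ (n - 1)` act on words as the full twist, so `1 - R` is
onto and `1 - R'` is injective.

Arithmetic: the ranks provide independent commutators `c₀`, `c₁` and a relation `g₀ ^ a * g₁ ^ b =
1` with `a, b ≠ 0`. As `g₁ ^ b = g₀ ^ (-a)`, conjugation by `g₁` has an eigenvector among the
elements of weight `g₀` and commutator `c₀`, with eigenvalue `d₀` satisfying `d₀ ^ b = c₀ ^ (-a)`;
likewise `d₁ ^ a = c₁ ^ (-b)`. The `ab`-th power of the full twist of a word with `s` letters `0`
and `t` letters `1` is then `c₀ ^ (ab s(s-1) - a² st) * c₁ ^ (ab t(t-1) - b² st)`. Independence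
makes both exponents vanish if the twist is `1`, which forces `s + t ≤ 1`. -/

namespace HopfGrowth

/-! ### Diagonal braidings on words: rotations and full twists. -/

section Words

variable {k ι : Type*} [Field k]

/-- The scalar picked up by the letter `i` when it is moved to the front of `i w`
from behind the word `w`. -/
def braidWord (q : ι → ι → k) (i : ι) (w : List ι) : k := (w.map (q i)).prod

/-- The scalar by which the full twist acts on a word, that is, the product of the `q i j` over all
ordered pairs of distinct positions. -/
def fullTwist (q : ι → ι → k) : List ι → k
  | [] => 1
  | l :: v => fullTwist q v * braidWord q l v * braidWord (fun i j => q j i) l v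

variable (q : ι → ι → k)

@[simp] lemma braidWord_nil (i : ι) : braidWord q i [] = 1 := by simp [braidWord]

@[simp] lemma braidWord_cons (i l : ι) (w : List ι) :
    braidWord q i (l :: w) = q i l * braidWord q i w := by simp [braidWord]

@[simp] lemma braidWord_append (i : ι) (u w : List ι) :
    braidWord q i (u ++ w) = braidWord q i u * braidWord q i w := by simp [braidWord]

lemma braidWord_perm (i : ι) {u w : List ι} (h : u.Perm w) :
    braidWord q i u = braidWord q i w := (h.map _).prod_eq

lemma fullTwist_concat (v : List ι) (i : ι) :
    fullTwist q (v ++ [i]) =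
      fullTwist q v * braidWord q i v * braidWord (fun i j => q j i) i v := by
  induction v with
  | nil => simp [fullTwist]
  | cons l v ih =>
    simp only [List.cons_append, fullTwist, ih, braidWord_append, braidWord_cons, braidWord_nil]
    ring

/-- Prepending a letter. -/
noncomputable def consLetter (i : ι) : (List ι →₀ k) →ₗ[k] (List ι →₀ k) :=
  Finsupp.lmapDomain k k (List.cons i)

/-- Appending a letter. -/
noncomputable def snocLetter (i : ι) : (List ι →₀ k) →ₗ[k] (List ι →₀ k) :=
  Finsupp.lmapDomain k k (fun u => u ++ [i])

@[simp] lemma consLetter_single (i : ι) (w : List ι) (c : k) :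
    consLetter i (Finsupp.single w c) = Finsupp.single (i :: w) c := by
  simp [consLetter]

@[simp] lemma snocLetter_single (i : ι) (w : List ι) (c : k) :
    snocLetter i (Finsupp.single w c) = Finsupp.single (w ++ [i]) c := by
  simp [snocLetter]

lemma snocLetter_consLetter (i l : ι) (a : List ι →₀ k) :
    snocLetter i (consLetter l a) = consLetter l (snocLetter i a) := by
  induction a using Finsupp.induction_linear with
  | zero => simp
  | add f g hf hg => simp [hf, hg]
  | single w c => simp

/-- The homogeneous elements of degree `n`. -/
noncomputable def homogeneousWords (k ι : Type*) [Field k] (n : ℕ) : Submodule k (List ι →₀ k) :=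
  Finsupp.supported k k {w | w.length = n}

lemma single_mem_homogeneousWords (w : List ι) (c : k) :
    Finsupp.single w c ∈ homogeneousWords k ι w.length :=
  Finsupp.single_mem_supported k c rfl

/-- A linear map between free modules maps supported elements into a submodule as soon as
it does so for the basis elements. -/
lemma map_supported_mem {M α : Type*} [AddCommGroup M] [Module k M] {s : Set α}
    (f : (α →₀ k) →ₗ[k] M) (N : Submodule k M)
    (h : ∀ w ∈ s, f (Finsupp.single w 1) ∈ N) {a : α →₀ k} (ha : a ∈ Finsupp.supported k k s) :
    f a ∈ N := by
  rw [Finsupp.supported_eq_span_single] at ha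
  have : Submodule.span k ((fun i => Finsupp.single i (1 : k)) '' s) ≤ N.comap f := by
    rw [Submodule.span_le]
    rintro _ ⟨w, hw, rfl⟩
    exact h w hw
  exact this ha

/-- Two linear maps agree on supported elements as soon as they do so on basis elements. -/
lemma eq_on_supported {M α : Type*} [AddCommGroup M] [Module k M] {s : Set α}
    (f g : (α →₀ k) →ₗ[k] M)
    (h : ∀ w ∈ s, f (Finsupp.single w 1) = g (Finsupp.single w 1)) {a : α →₀ k}
    (ha : a ∈ Finsupp.supported k k s) : f a = g a := by
  have := map_supported_mem (f - g) ⊥ (fun w hw => by simp [h w hw]) ha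
  simpa [sub_eq_zero] using this

/-- Moving the last letter of a word to the front, with the braiding. -/
noncomputable def rotateWord (w : List ι) : List ι →₀ k :=
  match w.reverse with
  | [] => Finsupp.single [] 1
  | i :: u => Finsupp.single (i :: u.reverse) (braidWord q i u.reverse)

/-- The linear extension of `rotateWord`. -/
noncomputable def rotate : (List ι →₀ k) →ₗ[k] (List ι →₀ k) :=
  Finsupp.linearCombination k (rotateWord q)

@[simp] lemma rotate_single_concat (u : List ι) (i : ι) (c : k) :
    rotate q (Finsupp.single (u ++ [i]) c) = Finsupp.single (i :: u) (c * braidWord q i u) := by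
  simp [rotate, rotateWord]

/-- The braiding of the first two letters of a word. -/
noncomputable def braidWordHead (w : List ι) : List ι →₀ k :=
  match w with
  | i :: l :: u => Finsupp.single (l :: i :: u) (q l i)
  | u => Finsupp.single u 1

/-- The linear extension of `braidWordHead`. -/
noncomputable def braidHead : (List ι →₀ k) →ₗ[k] (List ι →₀ k) :=
  Finsupp.linearCombination k (braidWordHead q)

@[simp] lemma braidHead_single (u : List ι) (i l : ι) (c : k) :
    braidHead q (Finsupp.single (i :: l :: u) c) = Finsupp.single (l :: i :: u) (c * q l i) := by
  simp [braidHead, braidWordHead]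

/-- Rotating all letters but the first one, which is braided around. -/
noncomputable def rotateTail : (List ι →₀ k) →ₗ[k] (List ι →₀ k) := braidHead q ∘ₗ rotate q

lemma rotateTail_single_concat (u : List ι) (l i : ι) (c : k) :
    rotateTail q (Finsupp.single (l :: (u ++ [i])) c) =
      Finsupp.single (l :: i :: u) (c * braidWord q i (l :: u) * q l i) := by
  rw [← List.cons_append, rotateTail, LinearMap.comp_apply, rotate_single_concat, braidHead_single]

/-- The prefix `u` is there for the induction. With `u = []`, a full cycle of rotations fixes each
word up to its full twist. -/
lemma rotate_pow_single (v : List ι) : ∀ (u : List ι) (c : k),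
    ((rotate q) ^ v.length) (Finsupp.single (u ++ v) c) =
      Finsupp.single (v ++ u) (c * ((v.map fun j => braidWord q j u).prod * fullTwist q v)) := by
  induction v using List.reverseRecOn with
  | nil => intro u c; simp [fullTwist]
  | append_singleton v i ih =>
    intro u c
    rw [List.length_append, List.length_singleton, pow_succ, Module.End.mul_apply,
      ← List.append_assoc, rotate_single_concat, ← List.cons_append, ih, fullTwist_concat]
    congr 1
    · simp
    · simp only [braidWord_append, braidWord_cons, List.prod_map_mul, List.map_append,
        List.prod_append, List.map_cons, List.map_nil, List.prod_cons, List.prod_nil]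
      simp only [braidWord]
      ring

/-- Each moved letter passes `l` in both directions. For `u = []` the scalar is therefore the full
twist of all of `l :: v`, reached after only `v.length` steps. -/
lemma rotateTail_pow_single (l : ι) (v : List ι) : ∀ (u : List ι) (c : k),
    ((rotateTail q) ^ v.length) (Finsupp.single (l :: (u ++ v)) c) =
      Finsupp.single (l :: (v ++ u)) (c * ((v.map fun j => braidWord q j u).prod * fullTwist q v *
        (braidWord q l v * braidWord (fun i j => q j i) l v))) := by
  induction v using List.reverseRecOn with
  | nil => intro u c; simp [fullTwist]
  | append_singleton v i ih =>
    intro u c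
    rw [List.length_append, List.length_singleton, pow_succ, Module.End.mul_apply,
      ← List.append_assoc, rotateTail_single_concat, ← List.cons_append, ih, fullTwist_concat]
    congr 1
    · simp
    · simp only [braidWord_append, braidWord_cons, List.prod_map_mul, List.map_append,
        List.prod_append, List.map_cons, List.map_nil, List.prod_cons, List.prod_nil]
      simp only [braidWord, List.map_nil, List.prod_nil]
      ring

lemma rotate_mem {n : ℕ} {a : List ι →₀ k} (ha : a ∈ homogeneousWords k ι n) :
    rotate q a ∈ homogeneousWords k ι n := by
  refine map_supported_mem _ _ (fun w hw => ?_) ha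
  rcases List.eq_nil_or_concat w with rfl | ⟨u, i, rfl⟩
  · simp only [rotate, Finsupp.linearCombination_single, one_smul, rotateWord, List.reverse_nil]
    exact Finsupp.single_mem_supported k _ hw
  · rw [List.concat_eq_append] at hw ⊢
    rw [rotate_single_concat]
    exact Finsupp.single_mem_supported k _ (by simpa using hw)

/-- `1 - rotate` is onto in degree `n ≥ 2` if no full twist is trivial there. -/
lemma exists_sub_rotate_eq (hq : ∀ w : List ι, 2 ≤ w.length → fullTwist q w ≠ 1) {n : ℕ}
    (hn : 2 ≤ n) {a : List ι →₀ k} (ha : a ∈ homogeneousWords k ι n) :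
    ∃ b ∈ homogeneousWords k ι n, b - rotate q b = a := by
  suffices a ∈ (homogeneousWords k ι n).map (LinearMap.id - rotate q) by
    obtain ⟨b, hb, h⟩ := this
    exact ⟨b, hb, by simpa using h⟩
  refine map_supported_mem LinearMap.id _ (fun w hw => ?_) ha
  have hw' : w.length = n := hw
  have htw := hq w (by omega)
  -- `1 - rotate` times the geometric sum is `1 - rotate ^ n`, which acts on `w` by `1 - fullTwist q
  -- w`.
  refine ⟨(1 - fullTwist q w)⁻¹ • ∑ m ∈ Finset.range n, ((rotate q) ^ m) (Finsupp.single w 1),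
    Submodule.smul_mem _ _ (Submodule.sum_mem _ fun m hm => ?_), ?_⟩
  · clear hm
    induction m with
    | zero => simpa [hw'] using single_mem_homogeneousWords (k := k) w 1
    | succ m ih =>
      rw [pow_succ', Module.End.mul_apply]
      exact rotate_mem q ih
  · have h1 := rotate_pow_single q w [] (1 : k)
    have h2 : ((1 : Module.End k (List ι →₀ k)) - rotate q) * ∑ m ∈ Finset.range n, (rotate q) ^ m
        = 1 - (rotate q) ^ n := mul_neg_geom_sum (rotate q : Module.End k (List ι →₀ k)) n
    have h3 := congrArg (fun f => f (Finsupp.single w (1 : k))) h2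
    simp only [Module.End.mul_apply, LinearMap.sum_apply] at h3
    change ((1 : Module.End k (List ι →₀ k)) - rotate q) _ = _
    rw [map_smul, h3]
    rw [hw'] at h1
    simp only [List.nil_append, List.append_nil, braidWord_nil] at h1
    rw [LinearMap.sub_apply, h1]
    simp only [List.map_const', List.prod_replicate, one_pow, one_mul, Module.End.one_apply]
    rw [← Finsupp.single_sub, Finsupp.smul_single, smul_eq_mul,
      inv_mul_cancel₀ (sub_ne_zero.2 (Ne.symm htw))]
    rfl

/-- `1 - rotateTail` is one-to-one in degree `n ≥ 2` if no full twist is trivial there. -/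
lemma eq_zero_of_rotateTail_eq (hq : ∀ w : List ι, 2 ≤ w.length → fullTwist q w ≠ 1) {n : ℕ}
    (hn : 2 ≤ n) {a : List ι →₀ k} (ha : a ∈ homogeneousWords k ι n)
    (h : rotateTail q a = a) : a = 0 := by
  have h1 : ∀ m, ((rotateTail q) ^ m) a = a := by
    intro m
    induction m with
    | zero => simp
    | succ m ih => rw [pow_succ, Module.End.mul_apply, h, ih]
  have h2 : ((rotateTail q) ^ (n - 1)) a =
      Finsupp.linearCombination k (fun w => Finsupp.single w (fullTwist q w)) a := by
    refine eq_on_supported _ _ (fun w hw => ?_) ha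
    obtain _ | ⟨l, v⟩ := w
    · have : (0 : ℕ) = n := hw
      omega
    · have hv : v.length = n - 1 := by
        have : v.length + 1 = n := hw
        omega
      have := rotateTail_pow_single q l v [] (1 : k)
      simp only [List.nil_append, List.append_nil, braidWord_nil, List.map_const',
        List.prod_replicate, one_pow, one_mul] at this
      rw [← hv, this]
      simp [fullTwist, mul_assoc]
  rw [h1] at h2
  ext w
  by_cases hw : w.length = n
  · have h3 : a w = a w * fullTwist q w := by
      conv_lhs => rw [h2]
      rw [Finsupp.linearCombination_apply, Finsupp.sum_apply, Finsupp.sum,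
        Finset.sum_eq_single w]
      · simp
      · intro b _ hb
        simp [hb]
      · intro hb
        simp [Finsupp.notMem_support_iff.1 hb]
    have h4 : a w * (1 - fullTwist q w) = 0 := by linear_combination h3
    simpa [sub_eq_zero, Ne.symm (hq w (by omega))] using h4
  · by_contra hne
    exact hw (ha (Finsupp.mem_support_iff.2 hne))

/-! ### Skew derivations and injectivity of `∑ xᵢ ∂ᵢ`. -/

variable [DecidableEq ι]

/-- The skew derivation `∂ᵢ` of the free algebra on words. -/
noncomputable def skewDerivWord (i : ι) : List ι → (List ι →₀ k)
  | [] => 0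
  | l :: v => (if l = i then Finsupp.single v 1 else 0) + q i l • consLetter l (skewDerivWord i v)

/-- The skew derivation `∂ᵢ` of the free algebra. -/
noncomputable def skewDeriv (i : ι) : (List ι →₀ k) →ₗ[k] (List ι →₀ k) :=
  Finsupp.linearCombination k (skewDerivWord q i)

@[simp] lemma skewDeriv_single (i : ι) (w : List ι) :
    skewDeriv q i (Finsupp.single w 1) = skewDerivWord q i w := by
  simp [skewDeriv]

lemma skewDerivWord_mem (i : ι) (w : List ι) :
    skewDerivWord q i w ∈ Finsupp.supported k k {v | (i :: v).Perm w} := by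
  induction w with
  | nil => exact Submodule.zero_mem _
  | cons l w ih =>
    refine Submodule.add_mem _ ?_ (Submodule.smul_mem _ _ ?_)
    · split_ifs with h
      · subst h
        exact Finsupp.single_mem_supported k _ (List.Perm.refl _)
      · exact Submodule.zero_mem _
    · refine map_supported_mem (consLetter l) _ (fun v hv => ?_) ih
      rw [consLetter_single]
      exact Finsupp.single_mem_supported k _ ((List.Perm.swap _ _ _).trans (hv.cons l))

/-- The twisted Leibniz rule read from the right: to delete the last letter, `∂ᵢ` first has to pass
all of `u`. -/
lemma skewDerivWord_concat (i j : ι) (u : List ι) :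
    skewDerivWord q i (u ++ [j]) = snocLetter j (skewDerivWord q i u) +
      if j = i then Finsupp.single u (braidWord q i u) else 0 := by
  induction u with
  | nil => simp [skewDerivWord]
  | cons l u ih =>
    rw [List.cons_append]
    simp only [skewDerivWord]
    rw [ih]
    simp only [map_add, map_smul, smul_add, snocLetter_consLetter, braidWord_cons]
    rw [add_assoc]
    congr 1
    · split_ifs <;> simp
    · congr 1
      split_ifs <;> simp

lemma skewDeriv_mem (i : ι) {n : ℕ} {a : List ι →₀ k} (ha : a ∈ homogeneousWords k ι (n + 1)) :
    skewDeriv q i a ∈ homogeneousWords k ι n := by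
  refine map_supported_mem _ _ (fun w hw => ?_) ha
  rw [skewDeriv_single]
  refine Finsupp.supported_mono ?_ (skewDerivWord_mem q i w)
  intro v hv
  have h1 := hv.length_eq
  have h2 : w.length = n + 1 := hw
  simp only [List.length_cons] at h1
  exact (by omega : v.length = n)

/-- Removing the last letter of a word if it is `i`. -/
noncomputable def stripWord (i : ι) (w : List ι) : List ι →₀ k :=
  match w.reverse with
  | [] => 0
  | j :: u => if j = i then Finsupp.single u.reverse 1 else 0

/-- The linear extension of `stripWord`. -/
noncomputable def strip (i : ι) : (List ι →₀ k) →ₗ[k] (List ι →₀ k) :=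
  Finsupp.linearCombination k (stripWord i)

lemma strip_single_concat (i j : ι) (u : List ι) (c : k) :
    strip i (Finsupp.single (u ++ [j]) c) = if j = i then Finsupp.single u c else 0 := by
  simp [strip, stripWord]

lemma strip_snocLetter (i j : ι) (a : List ι →₀ k) :
    strip i (snocLetter j a) = if j = i then a else 0 := by
  induction a using Finsupp.induction_linear with
  | zero => simp
  | add f g hf hg => rw [map_add, map_add, hf, hg]; split_ifs <;> simp
  | single w c => rw [snocLetter_single, strip_single_concat]

lemma strip_mem (i : ι) {n : ℕ} {a : List ι →₀ k} (ha : a ∈ homogeneousWords k ι (n + 1)) :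
    strip i a ∈ homogeneousWords k ι n := by
  refine map_supported_mem _ _ (fun w hw => ?_) ha
  rcases List.eq_nil_or_concat w with rfl | ⟨u, j, rfl⟩
  · exact absurd (show (0 : ℕ) = n + 1 from hw) (by omega)
  · rw [List.concat_eq_append] at hw ⊢
    rw [strip_single_concat]
    split_ifs
    · exact Finsupp.single_mem_supported k _ (by simpa using hw)
    · exact Submodule.zero_mem _

variable [Fintype ι]

/-- The operator `a ↦ ∑ᵢ xᵢ ∂ᵢ(a)`. -/
noncomputable def eulerOp : (List ι →₀ k) →ₗ[k] (List ι →₀ k) :=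
  ∑ i, consLetter i ∘ₗ skewDeriv q i

lemma eulerOp_single (w : List ι) :
    eulerOp q (Finsupp.single w 1) = ∑ i, consLetter i (skewDerivWord q i w) := by
  simp [eulerOp]

lemma eulerOp_single_mem (w : List ι) :
    eulerOp q (Finsupp.single w 1) ∈ Finsupp.supported k k {v | v.Perm w} := by
  rw [eulerOp_single]
  refine Submodule.sum_mem _ fun i _ => ?_
  refine map_supported_mem (consLetter i) _ (fun v hv => ?_) (skewDerivWord_mem q i w)
  rw [consLetter_single]
  exact Finsupp.single_mem_supported k _ hv

lemma sum_snocLetter_strip {n : ℕ} {a : List ι →₀ k} (ha : a ∈ homogeneousWords k ι (n + 1)) :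
    ∑ i, snocLetter i (strip i a) = a := by
  have : (∑ i, snocLetter i ∘ₗ strip i : (List ι →₀ k) →ₗ[k] (List ι →₀ k)) a
      = LinearMap.id (R := k) a := by
    refine eq_on_supported (∑ i, snocLetter i ∘ₗ strip i) LinearMap.id (fun w hw => ?_) ha
    rcases List.eq_nil_or_concat w with rfl | ⟨u, j, rfl⟩
    · exact absurd (show (0 : ℕ) = n + 1 from hw) (by omega)
    · rw [List.concat_eq_append, LinearMap.sum_apply, Finset.sum_eq_single j]
      · simp [strip_single_concat]
      · intro i _ hi
        simp [strip_single_concat, hi.symm]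
      · simp
  simpa using this

/-- `eulerOp` applied to a word without its last letter. -/
noncomputable def eulerOpInit : (List ι →₀ k) →ₗ[k] (List ι →₀ k) :=
  ∑ i, snocLetter i ∘ₗ eulerOp q ∘ₗ strip i

lemma eulerOpInit_single_concat (u : List ι) (i : ι) :
    eulerOpInit q (Finsupp.single (u ++ [i]) 1) =
      snocLetter i (eulerOp q (Finsupp.single u 1)) := by
  rw [eulerOpInit, LinearMap.sum_apply, Finset.sum_eq_single i]
  · simp [strip_single_concat]
  · intro j _ hj
    simp [strip_single_concat, hj.symm]
  · simp

/-- The factorization `E (1 - R) = (1 - R') E'`. The term of `E (u xᵢ)` that brings the last letter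
to the front cancels the term of `E (R (u xᵢ))` that keeps it there. -/
lemma eulerOp_sub_rotate_single (u : List ι) (i : ι) :
    eulerOp q (Finsupp.single (u ++ [i]) 1 - rotate q (Finsupp.single (u ++ [i]) 1)) =
      eulerOpInit q (Finsupp.single (u ++ [i]) 1) -
        rotateTail q (eulerOpInit q (Finsupp.single (u ++ [i]) 1)) := by
  have h1 : eulerOp q (Finsupp.single (u ++ [i]) 1) =
      snocLetter i (eulerOp q (Finsupp.single u 1)) +
        Finsupp.single (i :: u) (braidWord q i u) := by
    simp only [eulerOp_single, skewDerivWord_concat, map_add, Finset.sum_add_distrib, map_sum,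
      snocLetter_consLetter]
    congr 1
    rw [Finset.sum_eq_single i]
    · simp
    · intro j _ hj
      simp [hj.symm]
    · simp
  have h2 : eulerOp q (Finsupp.single (i :: u) 1) = Finsupp.single (i :: u) 1 +
      ∑ l, q l i • consLetter l (consLetter i (skewDerivWord q l u)) := by
    simp only [eulerOp_single, skewDerivWord, map_add, Finset.sum_add_distrib, map_smul]
    congr 1
    rw [Finset.sum_eq_single i]
    · simp
    · intro j _ hj
      simp [hj.symm]
    · simp
  -- All words in `E u` are permutations of `u`, so `i` picks up the same scalar when passing any of
  -- them.
  have h3 : rotateTail q (snocLetter i (eulerOp q (Finsupp.single u 1))) =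
      braidWord q i u • ∑ l, q l i • consLetter l (consLetter i (skewDerivWord q l u)) := by
    simp only [eulerOp_single, map_sum, Finset.smul_sum]
    refine Finset.sum_congr rfl fun l _ => ?_
    refine eq_on_supported (rotateTail q ∘ₗ snocLetter i ∘ₗ consLetter l)
      (braidWord q i u • q l i • (consLetter l ∘ₗ consLetter i)) (fun v hv => ?_)
      (skewDerivWord_mem q l u)
    simp only [LinearMap.comp_apply, consLetter_single, snocLetter_single, LinearMap.smul_apply,
      List.cons_append, rotateTail_single_concat, braidWord_perm q i hv]
    simp
  have h4 : Finsupp.single (i :: u) (1 * braidWord q i u) =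
      braidWord q i u • Finsupp.single (i :: u) (1 : k) := by simp
  rw [eulerOpInit_single_concat, h3, map_sub, h1, rotate_single_concat, h4, map_smul, h2]
  rw [smul_add, ← h4, one_mul]
  abel

/-- **Nondegeneracy of the quantum symmetrizer.** -/
theorem eq_zero_of_eulerOp_eq_zero (hq : ∀ w : List ι, 2 ≤ w.length → fullTwist q w ≠ 1) :
    ∀ {n : ℕ} {a : List ι →₀ k}, a ∈ homogeneousWords k ι (n + 1) → eulerOp q a = 0 → a = 0 := by
  intro n
  induction n with
  | zero =>
    intro a ha h
    have : eulerOp q a = LinearMap.id (R := k) a := by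
      refine eq_on_supported (eulerOp q) LinearMap.id (fun w hw => ?_) ha
      obtain ⟨i, rfl⟩ := List.length_eq_one_iff.1 hw
      rw [eulerOp_single, Finset.sum_eq_single i]
      · simp [skewDerivWord]
      · intro j _ hj
        simp [skewDerivWord, hj.symm]
      · simp
    simpa [h] using this.symm
  | succ n ih =>
    intro a ha h
    obtain ⟨b, hb, rfl⟩ := exists_sub_rotate_eq q hq (by omega) ha
    have h1 : eulerOp q (b - rotate q b) = eulerOpInit q b - rotateTail q (eulerOpInit q b) := by
      refine eq_on_supported (eulerOp q ∘ₗ (LinearMap.id - rotate q))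
        ((LinearMap.id - rotateTail q) ∘ₗ eulerOpInit q) (fun w hw => ?_) hb
      rcases List.eq_nil_or_concat w with rfl | ⟨u, j, rfl⟩
      · exact absurd (show (0 : ℕ) = n + 1 + 1 from hw) (by omega)
      · rw [List.concat_eq_append]
        exact eulerOp_sub_rotate_single q u j
    have h2 : eulerOpInit q b ∈ homogeneousWords k ι (n + 1 + 1) := by
      refine map_supported_mem _ _ (fun w hw => ?_) hb
      rcases List.eq_nil_or_concat w with rfl | ⟨u, j, rfl⟩
      · exact absurd (show (0 : ℕ) = n + 1 + 1 from hw) (by omega)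
      · rw [List.concat_eq_append] at hw ⊢
        rw [eulerOpInit_single_concat]
        refine map_supported_mem (snocLetter j) _ (fun v hv => ?_) (eulerOp_single_mem q u)
        rw [snocLetter_single]
        refine Finsupp.single_mem_supported k _ ?_
        have := hv.length_eq
        simp only [Set.mem_ofPred_eq, List.length_append, List.length_singleton] at hw ⊢
        omega
    have h3 : eulerOpInit q b = 0 := by
      refine eq_zero_of_rotateTail_eq q hq (by omega) h2 ?_
      rw [h, eq_comm, sub_eq_zero] at h1
      exact h1.symm
    -- Comparing last letters in `E' b = 0` gives `E (strip i b) = 0` for each `i`, one degree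
    -- lower.
    have h4 : b = 0 := by
      rw [← sum_snocLetter_strip hb]
      refine Finset.sum_eq_zero fun i _ => ?_
      rw [ih (strip_mem i hb) ?_, map_zero]
      have := congrArg (strip i) h3
      rw [eulerOpInit, LinearMap.sum_apply, map_sum, map_zero, Finset.sum_eq_single i] at this
      · simpa [strip_snocLetter] using this
      · intro j _ hj
        simp [strip_snocLetter, hj]
      · simp
    simp [h4]

end Words

/-! ### Words in skew primitive elements of a Hopf algebra. -/

section SkewPrimitives

variable {k H : Type*} [Field k] [Ring H]

/-- The span in `H ⊗ H` of the pure tensors with factors in `P` and `Q`. -/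
def tensorSpan [Algebra k H] (P Q : Submodule k H) : Submodule k (H ⊗[k] H) :=
  Submodule.map₂ (TensorProduct.mk k H H) P Q

lemma tmul_mem_tensorSpan [Algebra k H] {P Q : Submodule k H} {x y : H} (hx : x ∈ P)
    (hy : y ∈ Q) : x ⊗ₜ[k] y ∈ tensorSpan P Q :=
  Submodule.apply_mem_map₂ _ hx hy

lemma tensorSpan_mono [Algebra k H] {P Q P' Q' : Submodule k H} (hP : P ≤ P') (hQ : Q ≤ Q') :
    tensorSpan P Q ≤ tensorSpan P' Q' :=
  Submodule.map₂_le_map₂ hP hQ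

lemma mul_mem_tensorSpan [Algebra k H] {P Q P' Q' : Submodule k H} {x y : H ⊗[k] H}
    (hx : x ∈ tensorSpan P Q) (hy : y ∈ tensorSpan P' Q') :
    x * y ∈ tensorSpan (P * P') (Q * Q') := by
  have h : tensorSpan P Q ≤ (tensorSpan (P * P') (Q * Q')).comap (LinearMap.mulRight k y) := by
    refine Submodule.map₂_le.2 fun p hp r hr => ?_
    have h' : tensorSpan P' Q' ≤
        (tensorSpan (P * P') (Q * Q')).comap (LinearMap.mulLeft k (p ⊗ₜ[k] r)) := by
      refine Submodule.map₂_le.2 fun p' hp' r' hr' => ?_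
      simp only [Submodule.mem_comap, LinearMap.mulLeft_apply, TensorProduct.mk_apply,
        Algebra.TensorProduct.tmul_mul_tmul]
      exact tmul_mem_tensorSpan (Submodule.mul_mem_mul hp hp') (Submodule.mul_mem_mul hr hr')
    exact h' hy
  exact h hx

variable [HopfAlgebra k H]

lemma coe_mem_groupLikeSpan (g : GroupLike k H) : (g : H) ∈ groupLikeSpan k H :=
  Submodule.subset_span ⟨g, rfl⟩

lemma one_mem_groupLikeSpan : (1 : H) ∈ groupLikeSpan k H :=
  coe_mem_groupLikeSpan (k := k) (1 : GroupLike k H)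

lemma groupLikeSpan_mul_le : groupLikeSpan k H * groupLikeSpan k H ≤ groupLikeSpan k H := by
  rw [groupLikeSpan, Submodule.span_mul_span]
  refine Submodule.span_mono ?_
  rintro _ ⟨_, ⟨g, rfl⟩, _, ⟨h, rfl⟩, rfl⟩
  exact ⟨g * h, rfl⟩

lemma mul_mem_groupLikeSpan {x y : H} (hx : x ∈ groupLikeSpan k H) (hy : y ∈ groupLikeSpan k H) :
    x * y ∈ groupLikeSpan k H :=
  groupLikeSpan_mul_le (Submodule.mul_mem_mul hx hy)

lemma comul_mem_of_mem_groupLikeSpan {x : H} (hx : x ∈ groupLikeSpan k H) :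
    CoalgebraStruct.comul (R := k) x ∈ tensorSpan (groupLikeSpan k H) (groupLikeSpan k H) := by
  have : groupLikeSpan k H ≤ (tensorSpan (groupLikeSpan k H) (groupLikeSpan k H)).comap
      (CoalgebraStruct.comul (R := k)) := by
    refine Submodule.span_le.2 ?_
    rintro _ ⟨g, rfl⟩
    have := g.2.comul_eq_tmul_self
    simp only [Submodule.comap_coe, Set.mem_preimage, SetLike.mem_coe]
    rw [this]
    exact tmul_mem_tensorSpan (coe_mem_groupLikeSpan g) (coe_mem_groupLikeSpan g)
  exact this hx

/-! ### The degree filtration, shifted by one: words of length `n` lie in step `n + 1`, and step `0`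
is zero. -/

variable {ι : Type*}

/-- The space `C₀ + ∑ᵢ C₀ yᵢ`. -/
def firstStep (k : Type*) {H ι : Type*} [Field k] [Ring H] [HopfAlgebra k H] (y : ι → H) :
    Submodule k H :=
  groupLikeSpan k H ⊔ groupLikeSpan k H * Submodule.span k (Set.range y)

/-- The filtration `0, C₀, U C₀, U² C₀, …` where `U = C₀ + ∑ᵢ C₀ yᵢ`. -/
def wordFiltration (k : Type*) {H ι : Type*} [Field k] [Ring H] [HopfAlgebra k H] (y : ι → H) :
    ℕ → Submodule k H
  | 0 => ⊥
  | 1 => groupLikeSpan k H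
  | n + 2 => firstStep k y * wordFiltration k y (n + 1)

lemma groupLikeSpan_mul_firstStep_le (y : ι → H) :
    groupLikeSpan k H * firstStep k y ≤ firstStep k y := by
  rw [firstStep, Submodule.mul_sup, ← mul_assoc]
  exact sup_le_sup groupLikeSpan_mul_le (mul_le_mul' groupLikeSpan_mul_le le_rfl)

lemma generator_mem_firstStep (y : ι → H) (i : ι) : y i ∈ firstStep k y := by
  refine le_sup_right (a := groupLikeSpan k H) ?_
  have := Submodule.mul_mem_mul (one_mem_groupLikeSpan (k := k) (H := H))
    (Submodule.subset_span (R := k) (Set.mem_range_self (f := y) i))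
  rwa [one_mul] at this

lemma groupLikeSpan_mul_wordFiltration_le (y : ι → H) (n : ℕ) :
    groupLikeSpan k H * wordFiltration k y n ≤ wordFiltration k y n := by
  match n with
  | 0 => simp [wordFiltration]
  | 1 => exact groupLikeSpan_mul_le
  | n + 2 =>
    rw [wordFiltration, ← mul_assoc]
    exact mul_le_mul' (groupLikeSpan_mul_firstStep_le y) le_rfl

lemma firstStep_mul_wordFiltration_le (y : ι → H) (n : ℕ) :
    firstStep k y * wordFiltration k y n ≤ wordFiltration k y (n + 1) := by
  match n with
  | 0 => simp [wordFiltration]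
  | n + 1 => exact le_rfl

lemma wordFiltration_le_succ (y : ι → H) (n : ℕ) :
    wordFiltration k y n ≤ wordFiltration k y (n + 1) := by
  refine le_trans ?_ (firstStep_mul_wordFiltration_le y n)
  intro x hx
  have := Submodule.mul_mem_mul
    (le_sup_left (b := groupLikeSpan k H * Submodule.span k (Set.range y))
    (one_mem_groupLikeSpan (k := k) (H := H))) hx
  rwa [one_mul] at this

lemma wordFiltration_mono (y : ι → H) : Monotone (wordFiltration k y) :=
  monotone_nat_of_le_succ (wordFiltration_le_succ y)

/-- The linear map from words to `H` sending a word in the letters `i` to the corresponding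
product of the `y i`. -/
noncomputable def evalWords (k : Type*) {H ι : Type*} [Field k] [Ring H] [Algebra k H] (y : ι → H) :
    (List ι →₀ k) →ₗ[k] H :=
  Finsupp.linearCombination k fun w => (w.map y).prod

@[simp] lemma evalWords_single (y : ι → H) (w : List ι) :
    evalWords k y (Finsupp.single w 1) = (w.map y).prod := by
  simp [evalWords]

lemma evalWords_consLetter (y : ι → H) (i : ι) (a : List ι →₀ k) :
    evalWords k y (consLetter i a) = y i * evalWords k y a := by
  induction a using Finsupp.induction_linear with
  | zero => simp
  | add f g hf hg => simp [hf, hg, mul_add]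
  | single w c => simp [evalWords]

lemma prod_map_mem_wordFiltration (y : ι → H) (w : List ι) :
    (w.map y).prod ∈ wordFiltration k y (w.length + 1) := by
  induction w with
  | nil => exact one_mem_groupLikeSpan
  | cons l w ih =>
    rw [List.map_cons, List.prod_cons]
    exact firstStep_mul_wordFiltration_le y _
      (Submodule.mul_mem_mul (generator_mem_firstStep y l) ih)

lemma evalWords_mem_wordFiltration (y : ι → H) {n : ℕ} {a : List ι →₀ k}
    (ha : a ∈ homogeneousWords k ι n) : evalWords k y a ∈ wordFiltration k y (n + 1) := by
  refine map_supported_mem _ _ (fun w hw => ?_) ha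
  rw [evalWords_single, ← show w.length = n from hw]
  exact prod_map_mem_wordFiltration y w

variable {g : ι → GroupLike k H} {y : ι → H}

lemma comul_mem_of_mem_firstStep
    (hy : ∀ i, CoalgebraStruct.comul (R := k) (y i) = y i ⊗ₜ[k] (1 : H) + (g i : H) ⊗ₜ[k] y i)
    {x : H} (hx : x ∈ firstStep k y) :
    CoalgebraStruct.comul (R := k) x ∈
      tensorSpan (firstStep k y) (groupLikeSpan k H) ⊔ tensorSpan (groupLikeSpan k H) ⊤ := by
  have : firstStep k y ≤ (tensorSpan (firstStep k y) (groupLikeSpan k H) ⊔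
      tensorSpan (groupLikeSpan k H) ⊤).comap (CoalgebraStruct.comul (R := k)) := by
    refine sup_le ?_ ?_
    · intro x hx
      exact (tensorSpan_mono le_rfl le_top).trans le_sup_right (comul_mem_of_mem_groupLikeSpan hx)
    · rw [groupLikeSpan, Submodule.span_mul_span, Submodule.span_le]
      rintro _ ⟨_, ⟨h, rfl⟩, _, ⟨i, rfl⟩, rfl⟩
      have hh := h.2.comul_eq_tmul_self
      simp only [Submodule.comap_coe, Set.mem_preimage, SetLike.mem_coe, Bialgebra.comul_mul]
      rw [hh, hy, mul_add, Algebra.TensorProduct.tmul_mul_tmul, Algebra.TensorProduct.tmul_mul_tmul]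
      refine Submodule.add_mem_sup ?_ ?_
      · refine tmul_mem_tensorSpan (groupLikeSpan_mul_firstStep_le y (Submodule.mul_mem_mul
          (coe_mem_groupLikeSpan h) (generator_mem_firstStep y i))) ?_
        rw [mul_one]
        exact coe_mem_groupLikeSpan h
      · exact tmul_mem_tensorSpan (mul_mem_groupLikeSpan (coe_mem_groupLikeSpan h)
          (coe_mem_groupLikeSpan _)) trivial
  exact this hx

/-- In the product of two coproducts only the leading parts keep full degree on the left, and their
right factors lie in `C₀`; every other product loses a degree on the left. -/
lemma comul_mem_of_mem_wordFiltration
    (hy : ∀ i, CoalgebraStruct.comul (R := k) (y i) = y i ⊗ₜ[k] (1 : H) + (g i : H) ⊗ₜ[k] y i)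
    (n : ℕ) : ∀ {x : H}, x ∈ wordFiltration k y (n + 1) →
    CoalgebraStruct.comul (R := k) x ∈
      tensorSpan (wordFiltration k y (n + 1)) (groupLikeSpan k H) ⊔
        tensorSpan (wordFiltration k y n) ⊤ := by
  induction n with
  | zero =>
    intro x hx
    exact le_sup_left (α := Submodule k (H ⊗[k] H)) (comul_mem_of_mem_groupLikeSpan hx)
  | succ n ih =>
    intro x hx
    have : firstStep k y * wordFiltration k y (n + 1) ≤
        (tensorSpan (wordFiltration k y (n + 1 + 1)) (groupLikeSpan k H) ⊔
        tensorSpan (wordFiltration k y (n + 1)) ⊤).comap (CoalgebraStruct.comul (R := k)) := by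
      refine Submodule.mul_le.2 fun u hu v hv => ?_
      simp only [Submodule.mem_comap, Bialgebra.comul_mul]
      obtain ⟨a, ha, b, hb, hab⟩ := Submodule.mem_sup.1 (comul_mem_of_mem_firstStep hy hu)
      obtain ⟨c, hc, d, hd, hcd⟩ := Submodule.mem_sup.1 (ih hv)
      have habcd : (a + b) * (c + d) = a * c + (b * c + (a * d + b * d)) := by
        rw [mul_add, add_mul, add_mul]; abel
      rw [← hab, ← hcd, habcd]
      refine Submodule.add_mem_sup ?_ (Submodule.add_mem _ ?_ (Submodule.add_mem _ ?_ ?_))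
      · exact tensorSpan_mono le_rfl groupLikeSpan_mul_le (mul_mem_tensorSpan ha hc)
      · exact tensorSpan_mono (groupLikeSpan_mul_wordFiltration_le y _) le_top
          (mul_mem_tensorSpan hb hc)
      · exact tensorSpan_mono (firstStep_mul_wordFiltration_le y _) le_top
          (mul_mem_tensorSpan ha hd)
      · exact tensorSpan_mono ((groupLikeSpan_mul_wordFiltration_le y _).trans
          (wordFiltration_le_succ y n)) le_top (mul_mem_tensorSpan hb hd)
    exact this hx

variable {q : ι → ι → k} [DecidableEq ι] [Fintype ι]

/-- The component of `Δ(y_w)` of degree one in the second factor is given by the skew derivations,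
up to terms of lower degree in the first factor. -/
lemma comul_prod_map_sub_mem
    (hy : ∀ i, CoalgebraStruct.comul (R := k) (y i) = y i ⊗ₜ[k] (1 : H) + (g i : H) ⊗ₜ[k] y i)
    (hq : ∀ i l, y l * (g i : H) - q i l • ((g i : H) * y l) ∈ groupLikeSpan k H) (w : List ι) :
    CoalgebraStruct.comul (R := k) (w.map y).prod - ((w.map y).prod ⊗ₜ[k] (1 : H) +
      ∑ i, ((g i : H) * evalWords k y (skewDerivWord q i w)) ⊗ₜ[k] y i) ∈
      tensorSpan (wordFiltration k y (w.length - 1)) ⊤ := by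
  induction w with
  | nil =>
    simp [skewDerivWord, Algebra.TensorProduct.one_def]
  | cons l v ih =>
    set e := (v.map y).prod with he
    set r := CoalgebraStruct.comul (R := k) e - (e ⊗ₜ[k] (1 : H) +
      ∑ i, ((g i : H) * evalWords k y (skewDerivWord q i v)) ⊗ₜ[k] y i) with hr
    have h1 : CoalgebraStruct.comul (R := k) e = (e ⊗ₜ[k] (1 : H) +
      ∑ i, ((g i : H) * evalWords k y (skewDerivWord q i v)) ⊗ₜ[k] y i) + r := by
      rw [hr]; abel
    have h2 : ∑ i, ((g i : H) * evalWords k y (skewDerivWord q i (l :: v))) ⊗ₜ[k] y i =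
        ((g l : H) * e) ⊗ₜ[k] y l + ∑ i, (q i l • ((g i : H) * y l) *
          evalWords k y (skewDerivWord q i v)) ⊗ₜ[k] y i := by
      simp only [skewDerivWord, map_add, mul_add, TensorProduct.add_tmul, Finset.sum_add_distrib]
      congr 1
      · rw [Finset.sum_eq_single l]
        · simp [he]
        · intro i _ hi
          simp [hi.symm]
        · simp
      · refine Finset.sum_congr rfl fun i _ => ?_
        rw [map_smul, evalWords_consLetter, mul_smul_comm, smul_mul_assoc, mul_assoc]
    -- The error has three sources: moving `y l` past `g i` (an element of `C₀`), second factors `y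
    -- l * y i` of degree two, and the error `r` for `v`.
    have h3 : CoalgebraStruct.comul (R := k) ((l :: v).map y).prod -
        (((l :: v).map y).prod ⊗ₜ[k] (1 : H) +
        ∑ i, ((g i : H) * evalWords k y (skewDerivWord q i (l :: v))) ⊗ₜ[k] y i) =
        ∑ i, ((y l * (g i : H) - q i l • ((g i : H) * y l)) *
          evalWords k y (skewDerivWord q i v)) ⊗ₜ[k] y i +
        (∑ i, ((g l : H) * ((g i : H) * evalWords k y (skewDerivWord q i v))) ⊗ₜ[k] (y l * y i) +
          (y l ⊗ₜ[k] (1 : H) * r + (g l : H) ⊗ₜ[k] y l * r)) := by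
      rw [h2, List.map_cons, List.prod_cons, Bialgebra.comul_mul, ← he, h1, hy]
      simp only [add_mul, mul_add, Finset.mul_sum, Algebra.TensorProduct.tmul_mul_tmul, one_mul,
        mul_one, sub_mul, TensorProduct.sub_tmul, Finset.sum_sub_distrib, Finset.sum_add_distrib,
        mul_assoc]
      abel
    have hmem : ∀ i, evalWords k y (skewDerivWord q i v) ∈ wordFiltration k y v.length := by
      intro i
      obtain _ | ⟨m, v⟩ := v
      · simp [skewDerivWord]
      · have := skewDeriv_mem q i (single_mem_homogeneousWords (k := k) (m :: v) 1)
        rw [skewDeriv_single] at this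
        exact evalWords_mem_wordFiltration y this
    rw [h3, List.length_cons, Nat.add_sub_cancel]
    have hg : ∀ (x : H), x ∈ groupLikeSpan k H → ∀ {z : H}, z ∈ wordFiltration k y v.length →
        x * z ∈ wordFiltration k y v.length := fun x hx z hz =>
      groupLikeSpan_mul_wordFiltration_le y _ (Submodule.mul_mem_mul hx hz)
    refine Submodule.add_mem _ (Submodule.sum_mem _ fun i _ => ?_)
      (Submodule.add_mem _ (Submodule.sum_mem _ fun i _ => ?_) (Submodule.add_mem _ ?_ ?_))
    · exact tmul_mem_tensorSpan (hg _ (hq i l) (hmem i)) trivial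
    · exact tmul_mem_tensorSpan (hg _ (coe_mem_groupLikeSpan _)
        (hg _ (coe_mem_groupLikeSpan _) (hmem i))) trivial
    -- For empty `v` the truncated index `v.length - 1` is still `0`, so raising the filtration by
    -- one would be too weak; there `r` vanishes outright.
    · obtain _ | ⟨m, v⟩ := v
      · have : r = 0 := by simpa [wordFiltration, tensorSpan] using ih
        simp [this]
      · exact tensorSpan_mono (firstStep_mul_wordFiltration_le y _) le_top
          (mul_mem_tensorSpan (tmul_mem_tensorSpan (generator_mem_firstStep y l)
            (Submodule.mem_top (x := (1 : H)))) ih)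
    · exact tensorSpan_mono ((groupLikeSpan_mul_wordFiltration_le y _).trans
        (wordFiltration_mono y (Nat.sub_le _ _))) le_top
          (mul_mem_tensorSpan (tmul_mem_tensorSpan (coe_mem_groupLikeSpan (g l))
            (Submodule.mem_top (x := y l))) ih)

lemma comul_evalWords_sub_mem
    (hy : ∀ i, CoalgebraStruct.comul (R := k) (y i) = y i ⊗ₜ[k] (1 : H) + (g i : H) ⊗ₜ[k] y i)
    (hq : ∀ i l, y l * (g i : H) - q i l • ((g i : H) * y l) ∈ groupLikeSpan k H)
    {n : ℕ} {a : List ι →₀ k} (ha : a ∈ homogeneousWords k ι n) :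
    CoalgebraStruct.comul (R := k) (evalWords k y a) - (evalWords k y a ⊗ₜ[k] (1 : H) +
      ∑ i, ((g i : H) * evalWords k y (skewDeriv q i a)) ⊗ₜ[k] y i) ∈
      tensorSpan (wordFiltration k y (n - 1)) ⊤ := by
  have := map_supported_mem
    (CoalgebraStruct.comul (R := k) ∘ₗ evalWords k y -
      ((TensorProduct.mk k H H).flip 1 ∘ₗ evalWords k y +
      ∑ i, (TensorProduct.mk k H H).flip (y i) ∘ₗ LinearMap.mulLeft k (g i : H) ∘ₗ
        evalWords k y ∘ₗ skewDeriv q i))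
    (tensorSpan (wordFiltration k y (n - 1)) ⊤) (fun w hw => ?_) ha
  · simpa using this
  · have := comul_prod_map_sub_mem hy hq w
    rw [show w.length = n from hw] at this
    simpa using this

/-- Contract the second factor with a functional dual to `v j`, extended from the span of `v`. -/
lemma eq_zero_of_sum_tmul_eq_zero {M N : Type*} [AddCommGroup M] [Module k M] [AddCommGroup N]
    [Module k N] {v : ι → N} (hv : LinearIndependent k v) {m : ι → M}
    (h : ∑ i, m i ⊗ₜ[k] v i = 0) (j : ι) : m j = 0 := by
  obtain ⟨f, hf⟩ := LinearMap.exists_extend ((Finsupp.lapply j) ∘ₗ hv.repr)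
  have hfv : ∀ i, f (v i) = if i = j then 1 else 0 := by
    intro i
    have h1 := LinearMap.congr_fun hf ⟨v i, Submodule.subset_span ⟨i, rfl⟩⟩
    simp only [LinearMap.comp_apply, Submodule.subtype_apply] at h1
    rw [h1, hv.repr_eq_single i _ rfl]
    simp [Finsupp.single_apply]
  have h2 := congrArg (fun t => TensorProduct.rid k M (LinearMap.lTensor M f t)) h
  simpa [hfv] using h2

/-- Words in skew primitive elements that are linearly independent modulo `C₀` and commute
with their weights up to scalars (modulo `C₀`) are linearly independent if no full twist is
trivial. -/
theorem eq_zero_of_evalWords_mem_wordFiltration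
    (hy : ∀ i, CoalgebraStruct.comul (R := k) (y i) = y i ⊗ₜ[k] (1 : H) + (g i : H) ⊗ₜ[k] y i)
    (hq : ∀ i l, y l * (g i : H) - q i l • ((g i : H) * y l) ∈ groupLikeSpan k H)
    (hind : LinearIndependent k fun i => (groupLikeSpan k H).mkQ (y i))
    (htw : ∀ w : List ι, 2 ≤ w.length → fullTwist q w ≠ 1) :
    ∀ {n : ℕ} {a : List ι →₀ k}, a ∈ homogeneousWords k ι n →
      evalWords k y a ∈ wordFiltration k y n → a = 0 := by
  intro n
  induction n with
  | zero =>
    intro a ha h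
    have h1 : a = Finsupp.single [] (a []) := by
      ext w
      by_cases hw : w = []
      · subst hw; simp
      · rw [Finsupp.single_eq_of_ne hw]
        by_contra hne
        exact hw (List.length_eq_zero_iff.1 (ha (Finsupp.mem_support_iff.2 hne)))
    have h2 : a [] • (1 : H) = 0 := by
      have : evalWords k y a = 0 := h
      rw [h1] at this
      simpa [evalWords] using this
    have h3 : (1 : H) ≠ 0 := (IsGroupLikeElem.one (R := k) (A := H)).ne_zero
    rw [h1, (smul_eq_zero.1 h2).resolve_right h3, Finsupp.single_zero]
  | succ n ih =>
    intro a ha h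
    -- Modulo step `n` on the left and `C₀` on the right, only the terms with second factor `y i`
    -- can survive.
    set φ := TensorProduct.map (wordFiltration k y n).mkQ (groupLikeSpan k H).mkQ with hφ
    have hker1 : ∀ t ∈ tensorSpan (wordFiltration k y n) ⊤, φ t = 0 := by
      intro t ht
      have : tensorSpan (wordFiltration k y n) ⊤ ≤ LinearMap.ker φ := by
        refine Submodule.map₂_le.2 fun p hp r _ => ?_
        simp only [LinearMap.mem_ker, TensorProduct.mk_apply, hφ, TensorProduct.map_tmul]
        rw [Submodule.mkQ_apply, (Submodule.Quotient.mk_eq_zero _).2 hp, TensorProduct.zero_tmul]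
      exact this ht
    have hker2 : ∀ t ∈ tensorSpan (wordFiltration k y (n + 1)) (groupLikeSpan k H), φ t = 0 := by
      intro t ht
      have : tensorSpan (wordFiltration k y (n + 1)) (groupLikeSpan k H) ≤ LinearMap.ker φ := by
        refine Submodule.map₂_le.2 fun p _ r hr => ?_
        simp only [LinearMap.mem_ker, TensorProduct.mk_apply, hφ, TensorProduct.map_tmul]
        rw [Submodule.mkQ_apply (groupLikeSpan k H), (Submodule.Quotient.mk_eq_zero _).2 hr,
          TensorProduct.tmul_zero]
      exact this ht
    have h1 : φ (CoalgebraStruct.comul (R := k) (evalWords k y a)) = 0 := by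
      obtain ⟨s, hs, t, ht, hst⟩ := Submodule.mem_sup.1 (comul_mem_of_mem_wordFiltration hy n h)
      rw [← hst, map_add, hker1 t ht, hker2 s hs, add_zero]
    have h2 := comul_evalWords_sub_mem hy hq ha
    rw [Nat.add_sub_cancel] at h2
    replace h2 := hker1 _ h2
    rw [map_sub, map_add, h1,
      hker2 _ (tmul_mem_tensorSpan h one_mem_groupLikeSpan), zero_add, zero_sub, neg_eq_zero,
      map_sum] at h2
    simp only [hφ, TensorProduct.map_tmul] at h2
    have h3 : ∀ i, skewDeriv q i a = 0 := by
      intro i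
      refine ih (skewDeriv_mem q i ha) ?_
      have h4 := eq_zero_of_sum_tmul_eq_zero hind h2 i
      rw [Submodule.mkQ_apply, Submodule.Quotient.mk_eq_zero] at h4
      have h5 := groupLikeSpan_mul_wordFiltration_le y n
        (Submodule.mul_mem_mul (coe_mem_groupLikeSpan (g i)⁻¹) h4)
      rwa [← mul_assoc, ← GroupLike.val_mul, inv_mul_cancel, GroupLike.val_one, one_mul] at h5
    refine eq_zero_of_eulerOp_eq_zero q htw ha ?_
    simp [eulerOp, h3]

/-- Two or more skew primitive elements generating a free algebra yield exponential growth. -/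
theorem hasExponentialGrowth_of_fullTwist_ne_one [Nontrivial ι]
    (hy : ∀ i, CoalgebraStruct.comul (R := k) (y i) = y i ⊗ₜ[k] (1 : H) + (g i : H) ⊗ₜ[k] y i)
    (hq : ∀ i l, y l * (g i : H) - q i l • ((g i : H) * y l) ∈ groupLikeSpan k H)
    (hind : LinearIndependent k fun i => (groupLikeSpan k H).mkQ (y i))
    (htw : ∀ w : List ι, 2 ≤ w.length → fullTwist q w ≠ 1) :
    HasExponentialGrowth k H := by
  set V := Submodule.span k (Set.range y) with hV
  have hfin : FiniteDimensional k V := FiniteDimensional.span_of_finite k (Set.finite_range y)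
  refine ⟨V, hfin, Fintype.card ι, by exact_mod_cast Fintype.one_lt_card, fun n => ?_⟩
  have hfg : ((1 ⊔ V) ^ n : Submodule k H).FG :=
    ((Submodule.one_eq_span (R := k) (A := H) ▸ Submodule.fg_span_singleton _).sup
      (Module.Finite.iff_fg.1 hfin)).pow n
  have : FiniteDimensional k ↥((1 ⊔ V) ^ n) := Module.Finite.iff_fg.2 hfg
  have hmem : ∀ w : List ι, (w.map y).prod ∈ (1 ⊔ V) ^ w.length := by
    intro w
    induction w with
    | nil => simpa using Submodule.one_le.1 (le_refl (1 : Submodule k H))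
    | cons l w ih =>
      rw [List.map_cons, List.prod_cons, List.length_cons, pow_succ']
      exact Submodule.mul_mem_mul (le_sup_right (a := (1 : Submodule k H))
        (Submodule.subset_span ⟨l, rfl⟩)) ih
  let b : (Fin n → ι) → ↥((1 ⊔ V) ^ n) := fun f => ⟨((List.ofFn f).map y).prod, by
    simpa using hmem (List.ofFn f)⟩
  have hb : LinearIndependent k b := by
    -- A vanishing combination lies in every step of the filtration, so the freeness theorem applies
    -- to the words of length `n`.
    refine LinearIndependent.of_comp ((1 ⊔ V) ^ n).subtype ?_
    have h1 : LinearIndependent k fun f : Fin n → ι => Finsupp.single (List.ofFn f) (1 : k) :=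
      (Finsupp.linearIndependent_single_one k (List ι)).comp _ List.ofFn_injective
    rw [linearIndependent_iff] at h1 ⊢
    intro c hc
    refine h1 c (eq_zero_of_evalWords_mem_wordFiltration (n := n) hy hq hind htw ?_ ?_)
    · rw [Finsupp.linearCombination_apply]
      refine Submodule.sum_mem _ fun f _ => Submodule.smul_mem _ _ ?_
      exact Finsupp.single_mem_supported k _ (by simp)
    · have h2 : evalWords k y (Finsupp.linearCombination k
          (fun f : Fin n → ι => Finsupp.single (List.ofFn f) (1 : k)) c) = 0 := by
        rw [← hc, Finsupp.apply_linearCombination]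
        congr 2
        funext f
        simp [b]
      rw [h2]
      exact Submodule.zero_mem _
  have := hb.fintype_card_le_finrank
  rw [Fintype.card_fun, Fintype.card_fin] at this
  exact_mod_cast this

end SkewPrimitives

/-! ### Multiplicative dependence and torsionfree rank. -/

section Rank

/-- In an abelian group of torsionfree rank one, any two elements are multiplicatively
dependent. -/
lemma exists_zpow_mul_zpow_eq_one {A : Type*} [CommGroup A] (hA : torsionfreeRank A = 1)
    (x y : A) : ∃ m n : ℤ, (m ≠ 0 ∨ n ≠ 0) ∧ x ^ m * y ^ n = 1 := by
  by_contra! hcon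
  have hli : LinearIndependent ℤ ![Additive.ofMul x, Additive.ofMul y] := by
    rw [LinearIndependent.pair_iff]
    intro s t hst
    by_contra hne
    refine hcon s t (by tauto) ?_
    rw [← ofMul_zpow, ← ofMul_zpow, ← ofMul_mul] at hst
    exact ofMul_eq_zero.1 hst
  have h1 := hli.cardinal_lift_le_rank
  rw [torsionfreeRank] at hA
  rw [hA] at h1
  simp at h1

/-- A set generating a subgroup of torsionfree rank greater than one contains two multiplicatively
independent elements. -/
lemma exists_independent_pair {A : Type*} [CommGroup A] {S : Set A}
    (hS : 1 < torsionfreeRank (Subgroup.closure S)) :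
    ∃ x ∈ S, ∃ y ∈ S, ∀ m n : ℤ, x ^ m * y ^ n = 1 → m = 0 ∧ n = 0 := by
  by_contra! hcon
  -- If all pairs are dependent, any element of `S` of infinite order serves as `c`; if all of `S`
  -- is torsion, take `c = 1`.
  obtain ⟨c, hc⟩ : ∃ c : A, ∀ x ∈ S, ∃ n : ℤ, n ≠ 0 ∧ ∃ m : ℤ, x ^ n = c ^ m := by
    by_cases htor : ∃ c ∈ S, ∀ n : ℤ, c ^ n = 1 → n = 0
    · obtain ⟨c, hcS, hc⟩ := htor
      refine ⟨c, fun x hx => ?_⟩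
      obtain ⟨m, n, h, hmn⟩ := hcon c hcS x hx
      refine ⟨n, ?_, -m, ?_⟩
      · rintro rfl
        rw [zpow_zero, mul_one] at h
        exact hmn (hc m h) rfl
      · rw [zpow_neg, eq_inv_iff_mul_eq_one, mul_comm, h]
    · push Not at htor
      refine ⟨1, fun x hx => ?_⟩
      obtain ⟨n, h, hn⟩ := htor x hx
      exact ⟨n, hn, 0, by simpa using h⟩
  have hcl : ∀ x ∈ Subgroup.closure S, ∃ n : ℤ, n ≠ 0 ∧ ∃ m : ℤ, x ^ n = c ^ m := by
    intro x hx
    induction hx using Subgroup.closure_induction with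
    | mem x hx => exact hc x hx
    | one => exact ⟨1, one_ne_zero, 0, by simp⟩
    | mul x y _ _ hx hy =>
      obtain ⟨n, hn, m, h⟩ := hx
      obtain ⟨n', hn', m', h'⟩ := hy
      refine ⟨n * n', mul_ne_zero hn hn', m * n' + m' * n, ?_⟩
      rw [mul_zpow, zpow_mul, h, mul_comm n n', zpow_mul, h', zpow_add, zpow_mul, zpow_mul]
    | inv x _ hx =>
      obtain ⟨n, hn, m, h⟩ := hx
      exact ⟨n, hn, -m, by rw [inv_zpow, h, zpow_neg]⟩
  have h2 : ((2 : ℕ) : Cardinal) ≤ Module.rank ℤ (Additive (Subgroup.closure S)) := by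
    rw [Nat.cast_ofNat]
    exact Cardinal.two_le_iff_one_lt.2 hS
  obtain ⟨f, hf⟩ := natCast_le_rank_iff.1 h2
  obtain ⟨n, hn, m, h⟩ := hcl _ (f 0).toMul.2
  obtain ⟨n', hn', m', h'⟩ := hcl _ (f 1).toMul.2
  have hdep : ∀ i j : ℤ, (f 0).toMul ^ i * (f 1).toMul ^ j = 1 → i = 0 ∧ j = 0 := by
    intro i j hij
    have h3 : ∑ l, ![i, j] l • f l = 0 := by
      rw [Fin.sum_univ_two]
      exact congrArg Additive.ofMul hij
    have h4 := Fintype.linearIndependent_iff.1 hf _ h3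
    exact ⟨h4 0, h4 1⟩
  have hm' : m' ≠ 0 := by
    rintro rfl
    refine hn' (hdep 0 n' (Subtype.ext ?_)).2
    simpa using h'
  -- Suitable nonzero powers of both elements are powers of `c`; cross-multiplying the exponents
  -- gives a forbidden relation.
  refine mul_ne_zero hn hm' (hdep (n * m') (-(n' * m)) (Subtype.ext ?_)).1
  have h5 : ((f 0).toMul : A) ^ (n * m') = ((f 1).toMul : A) ^ (n' * m) := by
    rw [zpow_mul, h, zpow_mul, h', ← zpow_mul, ← zpow_mul, mul_comm]
  simp only [Subgroup.coe_mul, Subgroup.coe_zpow, Subgroup.coe_one, zpow_neg, Subgroup.coe_inv]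
  rw [h5, mul_inv_cancel]

end Rank

/-! ### Eigenvectors modulo a subspace. -/

section Eigenvector

variable {k V : Type*} [Field k] [AddCommGroup V] [Module k V]

/-- Apply the linear factors one at a time: the last vector still outside `C` is an eigenvector
modulo `C`. Only `N` has to be stable under `φ`. -/
lemma exists_eigenvector_mod_of_prod {φ : Module.End k V} {N C : Submodule k V}
    (hN : ∀ z ∈ N, φ z ∈ N) (s : Multiset k) : ∀ {z : V}, z ∈ N → z ∉ C →
    (Polynomial.aeval φ (s.map fun a => Polynomial.X - Polynomial.C a).prod) z ∈ C →
    ∃ y ∈ N, y ∉ C ∧ ∃ p ∈ s, φ y - p • y ∈ C := by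
  induction s using Multiset.induction_on with
  | empty =>
    intro z _ hzC h
    simp only [Multiset.map_zero, Multiset.prod_zero, map_one, Module.End.one_apply] at h
    exact absurd h hzC
  | cons a s ih =>
    intro z hz hzC h
    by_cases hza : φ z - a • z ∈ C
    · exact ⟨z, hz, hzC, a, Multiset.mem_cons_self a s, hza⟩
    · obtain ⟨y, hy, hyC, p, hp, h'⟩ := ih (z := φ z - a • z)
        (N.sub_mem (hN z hz) (N.smul_mem a hz)) hza (by
          rw [Multiset.map_cons, Multiset.prod_cons, mul_comm, map_mul, Module.End.mul_apply] at h
          simpa using h)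
      exact ⟨y, hy, hyC, p, Multiset.mem_cons_of_mem hp, h'⟩

/-- If a power of `φ` acts on `z` by a scalar modulo `C`, there is an eigenvector of `φ`
modulo `C`. -/
lemma exists_eigenvector_mod [IsAlgClosed k] {φ : Module.End k V} {N C : Submodule k V}
    (hN : ∀ z ∈ N, φ z ∈ N) {n : ℕ} (hn : n ≠ 0) {r : k} {z : V} (hz : z ∈ N) (hzC : z ∉ C)
    (h : (φ ^ n) z - r • z ∈ C) :
    ∃ y ∈ N, y ∉ C ∧ ∃ p : k, p ^ n = r ∧ φ y - p • y ∈ C := by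
  set P : Polynomial k := Polynomial.X ^ n - Polynomial.C r with hP
  have hmonic : P.Monic := Polynomial.monic_X_pow_sub_C r hn
  have hprod := (IsAlgClosed.splits P).eq_prod_roots_of_monic hmonic
  obtain ⟨y, hy, hyC, p, hp, h'⟩ := exists_eigenvector_mod_of_prod hN P.roots hz hzC (by
    rw [← hprod]
    simpa [hP] using h)
  refine ⟨y, hy, hyC, p, ?_, h'⟩
  have := Polynomial.isRoot_of_mem_roots hp
  simpa [hP, sub_eq_zero] using this

end Eigenvector

/-! ### Conjugation by group-like elements on skew primitives. -/

section Commutators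

variable {k H : Type*} [Field k] [Ring H] [HopfAlgebra k H]

/-- Conjugation by a group-like element. -/
def conjGroupLike (h : GroupLike k H) : Module.End k H :=
  LinearMap.mulLeft k ((h⁻¹ : GroupLike k H) : H) ∘ₗ LinearMap.mulRight k (h : H)

lemma conjGroupLike_apply (h : GroupLike k H) (x : H) :
    conjGroupLike h x = ((h⁻¹ : GroupLike k H) : H) * x * (h : H) := by
  simp only [conjGroupLike, LinearMap.comp_apply, LinearMap.mulLeft_apply,
    LinearMap.mulRight_apply, mul_assoc]

lemma conjGroupLike_one (x : H) : conjGroupLike (1 : GroupLike k H) x = x := by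
  rw [conjGroupLike_apply, inv_one, GroupLike.val_one, one_mul, mul_one]

lemma conjGroupLike_mul (h h' : GroupLike k H) (x : H) :
    conjGroupLike (h * h') x = conjGroupLike h' (conjGroupLike h x) := by
  simp only [conjGroupLike_apply, mul_inv_rev, GroupLike.val_mul, mul_assoc]

lemma conjGroupLike_pow (h : GroupLike k H) (n : ℕ) (x : H) :
    conjGroupLike (h ^ n) x = (conjGroupLike h ^ n) x := by
  induction n with
  | zero => rw [pow_zero, pow_zero, conjGroupLike_one, Module.End.one_apply]
  | succ n ih => rw [pow_succ, conjGroupLike_mul, ih, pow_succ', Module.End.mul_apply]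

lemma conjGroupLike_mem (h : GroupLike k H) {x : H} (hx : x ∈ groupLikeSpan k H) :
    conjGroupLike h x ∈ groupLikeSpan k H := by
  rw [conjGroupLike_apply]
  exact mul_mem_groupLikeSpan (mul_mem_groupLikeSpan (coe_mem_groupLikeSpan _) hx)
    (coe_mem_groupLikeSpan _)

lemma isCommutator_iff {h : GroupLike k H} {x : H} {c : kˣ} :
    IsCommutator h x c ↔ conjGroupLike h x - (c : k) • x ∈ groupLikeSpan k H := by
  rw [IsCommutator, conjGroupLike_apply]

lemma IsCommutator.mul_sub_mem {h : GroupLike k H} {x : H} {c : kˣ} (hc : IsCommutator h x c) :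
    x * (h : H) - (c : k) • ((h : H) * x) ∈ groupLikeSpan k H := by
  have h1 := mul_mem_groupLikeSpan (coe_mem_groupLikeSpan h) hc
  rwa [mul_sub, mul_smul_comm, ← mul_assoc, ← mul_assoc, ← GroupLike.val_mul, mul_inv_cancel,
    GroupLike.val_one, one_mul] at h1

/-- The pairs `(h, c)` such that conjugation by `h` acts on `x` as `c`, modulo `C₀`. -/
def commutatorSubgroup (x : H) : Subgroup (GroupLike k H × kˣ) where
  carrier := {p | IsCommutator p.1 x p.2}
  one_mem' := by
    simp [isCommutator_iff, conjGroupLike_one]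
  mul_mem' := by
    rintro ⟨h, c⟩ ⟨h', c'⟩ hc hc'
    have h1 := isCommutator_iff.1 hc
    have h2 := isCommutator_iff.1 hc'
    refine isCommutator_iff.2 ?_
    have h3 := Submodule.add_mem _ (conjGroupLike_mem h' h1) (Submodule.smul_mem _ (c : k) h2)
    have h4 : conjGroupLike (h * h') x - ((c * c' : kˣ) : k) • x =
        conjGroupLike h' (conjGroupLike h x - (c : k) • x) +
          (c : k) • (conjGroupLike h' x - (c' : k) • x) := by
      rw [conjGroupLike_mul, map_sub, map_smul, smul_sub, smul_smul, Units.val_mul]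
      abel
    change conjGroupLike (h * h') x - ((c * c' : kˣ) : k) • x ∈ _
    rw [h4]
    exact h3
  inv_mem' := by
    rintro ⟨h, c⟩ hc
    have h1 := isCommutator_iff.1 hc
    refine isCommutator_iff.2 ?_
    have h3 := Submodule.smul_mem _ (-((c⁻¹ : kˣ) : k)) (conjGroupLike_mem h⁻¹ h1)
    change conjGroupLike h⁻¹ x - ((c⁻¹ : kˣ) : k) • x ∈ _
    convert h3 using 1
    rw [map_sub, map_smul, ← conjGroupLike_mul, mul_inv_cancel, conjGroupLike_one, smul_sub,
      smul_smul, neg_mul, Units.inv_mul]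
    simp only [neg_smul, one_smul]
    abel

lemma IsCommutator.zpow {h : GroupLike k H} {x : H} {c : kˣ} (hc : IsCommutator h x c) (m : ℤ) :
    IsCommutator (h ^ m) x (c ^ m) :=
  (commutatorSubgroup x).zpow_mem (x := (h, c)) hc m

lemma IsCommutator.eq_one {x : H} {c : kˣ} (hc : IsCommutator (1 : GroupLike k H) x c)
    (hx : x ∉ groupLikeSpan k H) : c = 1 := by
  rw [isCommutator_iff, conjGroupLike_one] at hc
  by_contra hne
  refine hx ?_
  have h1 : (1 - (c : k)) ≠ 0 := by
    rw [sub_ne_zero]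
    exact fun h => hne (Units.ext h.symm)
  have h2 : x - (c : k) • x = (1 - (c : k)) • x := by rw [sub_smul, one_smul]
  rw [h2] at hc
  exact ((groupLikeSpan k H).smul_mem_iff h1).1 hc

/-- The elements `x` with `Δ x = x ⊗ 1 + g ⊗ x` on which conjugation by `g` acts as `c`
modulo `C₀`. -/
def skewEigenspace (g : GroupLike k H) (c : k) : Submodule k H :=
  LinearMap.ker (CoalgebraStruct.comul (R := k) -
      ((TensorProduct.mk k H H).flip 1 + TensorProduct.mk k H H (g : H))) ⊓
    (groupLikeSpan k H).comap (conjGroupLike g - c • LinearMap.id)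

lemma mem_skewEigenspace {g : GroupLike k H} {c : k} {x : H} :
    x ∈ skewEigenspace g c ↔
      CoalgebraStruct.comul (R := k) x = x ⊗ₜ[k] (1 : H) + (g : H) ⊗ₜ[k] x ∧
        conjGroupLike g x - c • x ∈ groupLikeSpan k H := by
  simp [skewEigenspace, sub_eq_zero]

/-- Since `h` commutes with `g`, conjugation by `h` preserves the weight `g` and commutes with
conjugation by `g`. -/
lemma conjGroupLike_mem_skewEigenspace {g h : GroupLike k H} (hgh : g * h = h * g) {c : k} {x : H}
    (hx : x ∈ skewEigenspace g c) : conjGroupLike h x ∈ skewEigenspace g c := by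
  rw [mem_skewEigenspace] at hx ⊢
  have hg : h⁻¹ * g * h = g := by rw [mul_assoc, hgh, inv_mul_cancel_left]
  constructor
  · have h1 := h.2.comul_eq_tmul_self
    have h2 := (h⁻¹).2.comul_eq_tmul_self
    rw [conjGroupLike_apply, Bialgebra.comul_mul, Bialgebra.comul_mul, hx.1, h1, h2, mul_add,
      add_mul]
    simp only [Algebra.TensorProduct.tmul_mul_tmul, mul_one]
    rw [← GroupLike.val_mul, ← GroupLike.val_mul, ← GroupLike.val_mul, hg, inv_mul_cancel,
      GroupLike.val_one]
  · have h1 := conjGroupLike_mem h hx.2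
    rwa [map_sub, map_smul, ← conjGroupLike_mul, hgh, conjGroupLike_mul] at h1

/-- A skew primitive element of weight `g` with commutator `c` can be replaced by one on which `h`
acts by a scalar as well, if a power of `h` is a power of `g`. -/
lemma exists_isCommutator_of_zpow_mul_zpow_eq_one [IsAlgClosed k] {g h : GroupLike k H}
    (hgh : g * h = h * g) {a b : ℤ} (hb : b ≠ 0) (hab : g ^ a * h ^ b = 1) {c : kˣ} {z : H}
    (hz : CoalgebraStruct.comul (R := k) z = z ⊗ₜ[k] (1 : H) + (g : H) ⊗ₜ[k] z)
    (hzC : z ∉ groupLikeSpan k H) (hc : IsCommutator g z c) :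
    ∃ y : H, CoalgebraStruct.comul (R := k) y = y ⊗ₜ[k] (1 : H) + (g : H) ⊗ₜ[k] y ∧
      y ∉ groupLikeSpan k H ∧ IsCommutator g y c ∧
        ∃ d : kˣ, c ^ a * d ^ b = 1 ∧ IsCommutator h y d := by
  -- Inverting the relation makes `b` a natural number, the degree of the polynomial `X ^ b - c ^
  -- (-a)` that annihilates `z` modulo `C₀`.
  wlog hpos : 0 < b generalizing a b
  · have hab' : g ^ (-a) * h ^ (-b) = 1 := by
      have hcomm : Commute (g ^ a) (h ^ b) := (show Commute g h from hgh).zpow_zpow a b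
      rw [zpow_neg, zpow_neg, ← mul_inv_rev, ← hcomm.eq, hab, inv_one]
    obtain ⟨y, h1, h2, h3, d, h4, h5⟩ := this (neg_ne_zero.2 hb) hab' (by omega)
    refine ⟨y, h1, h2, h3, d, ?_, h5⟩
    rw [zpow_neg, zpow_neg, ← mul_inv, inv_eq_one] at h4
    exact h4
  lift b to ℕ using hpos.le with n
  have hn : n ≠ 0 := by exact_mod_cast hb
  have hpow : h ^ n = g ^ (-a) := by
    rw [zpow_neg, eq_inv_iff_mul_eq_one, ← zpow_natCast]
    have hcomm : Commute (g ^ a) (h ^ (n : ℤ)) := (show Commute g h from hgh).zpow_zpow a n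
    rw [← hcomm.eq, hab]
  have hact : (conjGroupLike h ^ n) z - ((c ^ (-a) : kˣ) : k) • z ∈ groupLikeSpan k H := by
    rw [← conjGroupLike_pow, hpow]
    exact isCommutator_iff.1 (hc.zpow (-a))
  obtain ⟨y, hy, hyC, p, hp, hpy⟩ := exists_eigenvector_mod
    (fun x hx => conjGroupLike_mem_skewEigenspace hgh hx) hn
    (mem_skewEigenspace.2 ⟨hz, isCommutator_iff.1 hc⟩) hzC hact
  have hp0 : p ≠ 0 := by
    rintro rfl
    rw [zero_pow hn] at hp
    exact (c ^ (-a)).ne_zero hp.symm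
  obtain ⟨hy1, hy2⟩ := mem_skewEigenspace.1 hy
  refine ⟨y, hy1, hyC, isCommutator_iff.2 hy2, Units.mk0 p hp0, ?_, isCommutator_iff.2 hpy⟩
  have : (Units.mk0 p hp0) ^ n = c ^ (-a) := Units.ext (by simpa using hp)
  rw [zpow_natCast, this, ← zpow_add, add_neg_cancel, zpow_zero]

end Commutators

/-! ### Full twists in two letters. -/

section Twist

variable {k : Type*} [Field k]

lemma braidWord_fin_two (q : Fin 2 → Fin 2 → k) (i : Fin 2) (w : List (Fin 2)) :
    braidWord q i w = q i 0 ^ w.count 0 * q i 1 ^ w.count 1 := by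
  induction w with
  | nil => simp
  | cons l w ih =>
    rw [braidWord_cons, ih]
    fin_cases l <;> simp [pow_succ] <;> ring

/-- The twist has exponents `s(s-1)`, `st`, `t(t-1)`; multiplying by the diagonal factors avoids
subtraction in the exponents. -/
lemma fullTwist_fin_two (q : Fin 2 → Fin 2 → k) (w : List (Fin 2)) :
    fullTwist q w * (q 0 0 ^ w.count 0 * q 1 1 ^ w.count 1) =
      q 0 0 ^ (w.count 0 * w.count 0) * (q 0 1 * q 1 0) ^ (w.count 0 * w.count 1) *
        q 1 1 ^ (w.count 1 * w.count 1) := by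
  induction w with
  | nil => simp [fullTwist]
  | cons l w ih =>
    rw [fullTwist, braidWord_fin_two, braidWord_fin_two]
    have h : ∀ A B : k, fullTwist q w * A * B * (q 0 0 ^ w.count 0 * q 1 1 ^ w.count 1) =
      (q 0 0 ^ (w.count 0 * w.count 0) * (q 0 1 * q 1 0) ^ (w.count 0 * w.count 1) *
        q 1 1 ^ (w.count 1 * w.count 1)) * A * B := by
      intro A B
      rw [← ih]; ring
    fin_cases l
    · simp only [Fin.zero_eta, List.count_cons_self, ne_eq, zero_ne_one,
        not_false_eq_true, List.count_cons_of_ne, Fin.isValue]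
      rw [pow_succ (q 0 0), mul_right_comm (q 0 0 ^ w.count 0), ← mul_assoc, h]
      ring
    · simp only [List.count_cons_self, Fin.mk_one, ne_eq, one_ne_zero,
        not_false_eq_true, List.count_cons_of_ne, Fin.isValue]
      rw [pow_succ (q 1 1), ← mul_assoc (q 0 0 ^ w.count 0), ← mul_assoc, h]
      ring

lemma fullTwist_ne_one_of_independent {Q : Fin 2 → Fin 2 → kˣ}
    (hind : ∀ m n : ℤ, Q 0 0 ^ m * Q 1 1 ^ n = 1 → m = 0 ∧ n = 0) {a b : ℤ} (ha : a ≠ 0)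
    (hb : b ≠ 0) (h1 : Q 0 0 ^ a * Q 1 0 ^ b = 1) (h2 : Q 1 1 ^ b * Q 0 1 ^ a = 1)
    (w : List (Fin 2)) (hw : 2 ≤ w.length) : fullTwist (fun i j => (Q i j : k)) w ≠ 1 := by
  intro htw
  have hlen : w.count 0 + w.count 1 = w.length := by
    clear hw htw
    induction w with
    | nil => rfl
    | cons l w ih => fin_cases l <;> simp <;> omega
  have h3 := fullTwist_fin_two (fun i j => (Q i j : k)) w
  rw [htw, one_mul] at h3
  generalize w.count 0 = s at *
  generalize w.count 1 = t at *
  rw [← hlen] at hw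
  have h4 : Q 0 0 ^ s * Q 1 1 ^ t =
      Q 0 0 ^ (s * s) * (Q 0 1 * Q 1 0) ^ (s * t) * Q 1 1 ^ (t * t) :=
    Units.ext (by simpa using h3)
  have h5 : Q 1 0 ^ b = Q 0 0 ^ (-a) := by
    rw [zpow_neg, eq_inv_iff_mul_eq_one, mul_comm, h1]
  have h6 : Q 0 1 ^ a = Q 1 1 ^ (-b) := by
    rw [zpow_neg, eq_inv_iff_mul_eq_one, mul_comm, h2]
  have h7 : (Q 0 1 * Q 1 0) ^ ((s * t : ℕ) * (a * b) : ℤ) =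
      Q 1 1 ^ (-b * (b * (s * t))) * Q 0 0 ^ (-a * (a * (s * t))) := by
    rw [mul_zpow, show ((s * t : ℕ) * (a * b) : ℤ) = a * (b * (s * t)) by push_cast; ring,
      zpow_mul, h6, ← zpow_mul, show a * (b * (s * t : ℤ)) = b * (a * (s * t)) by ring,
      zpow_mul (Q 1 0), h5, ← zpow_mul]
  -- The power `a * b` is what lets both off-diagonal entries be rewritten in the diagonal ones.
  have h8 := congrArg (fun x => x ^ (a * b)) h4
  simp only [mul_zpow (_ * _), mul_zpow (Q 0 0 ^ _)] at h8
  simp only [← zpow_natCast, ← zpow_mul] at h8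
  rw [h7] at h8
  have key : ∀ (x y : kˣ) (A B C D E F : ℤ),
      x ^ C * y ^ F = x ^ A * (y ^ (-E) * x ^ (-B)) * y ^ D →
        x ^ (A - B - C) * y ^ (D - E - F) = 1 := by
    intro x y A B C D E F h
    rw [← div_eq_one.2 h.symm]
    simp only [zpow_sub, zpow_neg, div_eq_mul_inv, mul_inv]
    simp only [mul_comm, mul_left_comm, mul_assoc]
  rw [neg_mul, neg_mul] at h8
  obtain ⟨e1, e2⟩ := hind _ _ (key _ _ _ _ _ _ _ _ h8)
  push_cast at e1 e2
  have e3 : (s : ℤ) * (b * (s - 1) - a * t) = 0 :=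
    (mul_eq_zero.1 (by linear_combination e1 : a * ((s : ℤ) * (b * (s - 1) - a * t)) = 0)).resolve_left ha
  have e4 : (t : ℤ) * (a * (t - 1) - b * s) = 0 :=
    (mul_eq_zero.1 (by linear_combination e2 : b * ((t : ℤ) * (a * (t - 1) - b * s)) = 0)).resolve_left hb
  rcases mul_eq_zero.1 e3 with hs | hs
  · rw [hs] at e4
    rcases mul_eq_zero.1 e4 with ht | ht
    · omega
    · rw [mul_zero, sub_zero] at ht
      have := (mul_eq_zero.1 ht).resolve_left ha
      omega
  · rcases mul_eq_zero.1 e4 with ht | ht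
    · rw [ht, mul_zero, sub_zero] at hs
      have := (mul_eq_zero.1 hs).resolve_left hb
      omega
    -- With both letters present, adding the equations gives `a + b = 0`, and then `s + t = 1`.
    · have hba : b = -a := by linear_combination -hs - ht
      rw [hba] at ht
      have : (t : ℤ) - 1 + s = 0 :=
        (mul_eq_zero.1 (by linear_combination ht : a * ((t : ℤ) - 1 + s) = 0)).resolve_left ha
      omega

end Twist

end HopfGrowth

/-! ### Choice of the two skew primitive elements. -/

theorem proposition0p5 {k : Type*} {H : Type*} [Field k] [IsAlgClosed k] [CharZero k]
    [Ring H] [HopfAlgebra k H]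
    [IsMulCommutative ↥(Subgroup.closure (HopfGrowth.weights k H))]
    [IsMulTorsionFree ↥(Subgroup.closure (HopfGrowth.weights k H))]
    (hW : HopfGrowth.torsionfreeRank ↥(Subgroup.closure (HopfGrowth.weights k H)) = 1)
    (hΓ : 1 < HopfGrowth.torsionfreeRank ↥(Subgroup.closure (HopfGrowth.commutators k H))) :
    HopfGrowth.HasExponentialGrowth k H := by
  open HopfGrowth in
  obtain ⟨c₀, ⟨g₀, z₀, hz₀, hzC₀, hc₀⟩, c₁, ⟨g₁, z₁, hz₁, hzC₁, hc₁⟩, hind⟩ :=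
    exists_independent_pair hΓ
  let w₀ : Subgroup.closure (weights k H) := ⟨g₀, Subgroup.subset_closure ⟨z₀, hz₀, hzC₀⟩⟩
  let w₁ : Subgroup.closure (weights k H) := ⟨g₁, Subgroup.subset_closure ⟨z₁, hz₁, hzC₁⟩⟩
  have hcomm : g₀ * g₁ = g₁ * g₀ := congrArg Subtype.val (mul_comm w₀ w₁)
  obtain ⟨a, b, hab, hg⟩ := exists_zpow_mul_zpow_eq_one hW w₀ w₁
  replace hg : g₀ ^ a * g₁ ^ b = 1 := congrArg Subtype.val hg
  -- If `a = 0` then `g₁ ^ b = 1`, hence `c₁ ^ b = 1`, against the independence of `c₀` and `c₁`.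
  have ha : a ≠ 0 := by
    rintro rfl
    rw [zpow_zero, one_mul] at hg
    have h1 := hc₁.zpow b
    rw [hg] at h1
    have h2 := hind 0 b (by rw [zpow_zero, one_mul, h1.eq_one hzC₁])
    tauto
  have hb : b ≠ 0 := by
    rintro rfl
    rw [zpow_zero, mul_one] at hg
    have h1 := hc₀.zpow a
    rw [hg] at h1
    have h2 := hind a 0 (by rw [zpow_zero, mul_one, h1.eq_one hzC₀])
    tauto
  have hg' : g₁ ^ b * g₀ ^ a = 1 := by
    rw [← ((show Commute g₀ g₁ from hcomm).zpow_zpow a b).eq, hg]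
  obtain ⟨y₀, hy₀, hyC₀, hc₀', d₀, hd₀, hdy₀⟩ :=
    exists_isCommutator_of_zpow_mul_zpow_eq_one hcomm hb hg hz₀.2 hzC₀ hc₀
  obtain ⟨y₁, hy₁, hyC₁, hc₁', d₁, hd₁, hdy₁⟩ :=
    exists_isCommutator_of_zpow_mul_zpow_eq_one hcomm.symm ha hg' hz₁.2 hzC₁ hc₁
  -- The entry `Q i l` is the scalar by which conjugation by `gᵢ` acts on `yₗ`.
  let Q : Fin 2 → Fin 2 → kˣ := ![![c₀, d₁], ![d₀, c₁]]
  refine hasExponentialGrowth_of_fullTwist_ne_one (ι := Fin 2) (g := ![g₀, g₁]) (y := ![y₀, y₁])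
    (q := fun i j => (Q i j : k)) ?_ ?_ ?_
    (fullTwist_ne_one_of_independent (Q := Q) hind ha hb hd₀ hd₁)
  · intro i
    fin_cases i
    · exact hy₀
    · exact hy₁
  · intro i l
    fin_cases i <;> fin_cases l
    · exact hc₀'.mul_sub_mem
    · exact hdy₁.mul_sub_mem
    · exact hdy₀.mul_sub_mem
    · exact hc₁'.mul_sub_mem
  -- Modulo `C₀`, `y₀` and `y₁` are eigenvectors of conjugation by `g₀` for `c₀` and `d₁`. These
  -- differ, since `d₁ = c₀` would give `c₀ ^ a * c₁ ^ b = 1`.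
  · have hne : (c₀ : k) - (d₁ : k) ≠ 0 := by
      rw [sub_ne_zero]
      intro h
      rw [← Units.ext h, mul_comm] at hd₁
      exact ha (hind a b hd₁).1
    have h1 : (fun i => (groupLikeSpan k H).mkQ (![y₀, y₁] i)) =
        ![(groupLikeSpan k H).mkQ y₀, (groupLikeSpan k H).mkQ y₁] := by
      funext i
      fin_cases i <;> rfl
    rw [h1, LinearIndependent.pair_iff]
    intro s t hst
    rw [← map_smul, ← map_smul, ← map_add, Submodule.mkQ_apply,
      Submodule.Quotient.mk_eq_zero] at hst
    have h2 : ((c₀ : k) - d₁) • s • y₀ ∈ groupLikeSpan k H := by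
      have h3 := conjGroupLike_mem g₀ hst
      have h4 := Submodule.smul_mem _ s (isCommutator_iff.1 hc₀')
      have h5 := Submodule.smul_mem _ t (isCommutator_iff.1 hdy₁)
      have h6 := Submodule.smul_mem _ (d₁ : k) hst
      have h7 : ((c₀ : k) - d₁) • s • y₀ = conjGroupLike g₀ (s • y₀ + t • y₁) -
          s • (conjGroupLike g₀ y₀ - (c₀ : k) • y₀) - t • (conjGroupLike g₀ y₁ - (d₁ : k) • y₁) -
          (d₁ : k) • (s • y₀ + t • y₁) := by
        rw [map_add, map_smul, map_smul]
        module
      rw [h7]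
      exact Submodule.sub_mem _ (Submodule.sub_mem _ (Submodule.sub_mem _ h3 h4) h5) h6
    have hs : s = 0 := by
      by_contra hs
      exact hyC₀ (((groupLikeSpan k H).smul_mem_iff hs).1
        (((groupLikeSpan k H).smul_mem_iff hne).1 h2))
    refine ⟨hs, ?_⟩
    rw [hs, zero_smul, zero_add] at hst
    by_contra ht
    exact hyC₁ (((groupLikeSpan k H).smul_mem_iff ht).1 hst)
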